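/- Let $X_\tau$ be a site with a final object $X$, let $A$ be an abelian sheaf on $X_\tau$ (written additively), and let $G$ be a finite group. An *abelian gerbe* over $X$ is a stack in groupoids $\mathcal Y\to X_\tau$ such that (a) any two objects of $\mathcal Y$ over the same $U$ are isomorphic locally on a cover of $U$, (b) for every object $x$ of $\mathcal Y$ the automorphism group of $x$ in its fiber category is abelian, and (c) every object $U$ of $X_\tau$ has a cover over whose members $\mathcal Y$ has objects. It is *banded by $A$* if it is equipped with group isomorphisms $A(U)\cong \mathrm{Aut}_{\mathcal Y_U}(x)$, for all objects $U$ of $X_\tau$ and all $x\in\mathrm{Ob}(\mathcal Y_U)$, compatible with restriction and with conjugation by isomorphisms. A morphism of gerbes is a morphism of fibered categories over $X_\tau$; a 2-morphism is a base preserving natural transformation (it is automatically invertible). Every morphism $F:\mathcal Y\to\mathcal Y$ induces a homomorphism $\delta_F:A\to A$ such that $F$ maps the automorphism of $x$ given by a section $a$ to the automorphism of $F(x)$ given by $\delta_F(a)$. The 2-automorphisms of $F$ form a group isomorphic to $A(X)$: the element $a\in A(X)$ corresponds to the 2-automorphism whose value at $x\in\mathrm{Ob}(\mathcal Y_U)$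 is the automorphism of $F(x)$ given by $a|_U$. Let $\mathcal Y$ be an abelian gerbe banded by $A$. An *action of $G$ on $\mathcal Y$* is a family of morphisms $F_g:\mathcal Y\to\mathcal Y$, $g\in G$, such that $\delta_{F_1}=\mathrm{id}_A$ and such that $F_{gh}$ and $F_g\circ F_h$ are 2-isomorphic for all $g,h\in G$. Then $g\mapsto\delta_{F_g}$ is a left action of $G$ on $A$, the *underlying action*, which makes $A(X)$ a $G$-module. *Connecting 2-morphisms* are a choice $\alpha$ of 2-morphisms $\alpha_{g,h}:F_{gh}\to F_g\circ F_h$ for all $g,h\in G$. Let $\kappa_{(F,\alpha)}(g_1,g_2,g_3)\in A(X)$ be the element corresponding to the unique 2-automorphism $\kappa$ of $F_{g_1g_2g_3}$ with $$(\alpha_{g_1,g_2}\star \mathrm{id}_{F_{g_3}})\circ\alpha_{g_1g_2,g_3}\circ\kappa=(\mathrm{id}_{F_{g_1}}\star\alpha_{g_2,g_3})\circ\alpha_{g_1,g_2g_3}.$$ **Proposition 4.23.** For every action $F$ of $G$ on $\mathcal Y$ and every choice of connecting 2-morphisms $\alpha$, the 3-cochain $\kappa_{(F,\alpha)}:G^3\to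 A(X)$ is a cocycle for the underlying action. Its class in $H^3(G,A(X))$ is independent of the choice of the connecting 2-morphisms $\alpha$. -/

import Mathlib

open CategoryTheory Opposite Limits

universe u v₁ u₁ v₂ u₂ v₃ u₃

/-- A category `𝒴` over the site `(C, J)` is a stack in groupoids: it is fibered in groupoids,
morphisms between two objects over the same base object form a sheaf, and every descent datum
along a covering sieve is effective. Conditions are stated without choosing pullbacks: a morphism
`z ⟶ x` over `f` exhibits `z` as a pullback of `x` along `f`, because in a category fibered in
groupoids every morphism is cartesian. -/
structure IsStackInGroupoids {C : Type u₁} [Category.{v₁} C] (J : GrothendieckTopology C)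
    (𝒴 : BasedCategory.{v₂, u₂} C) : Prop where
  isFibered : 𝒴.p.IsFibered
  isGroupoid_fiber : ∀ U : C, IsGroupoid (𝒴.p.Fiber U)
  /-- Morphisms over `𝟙 U` from `x` to `y` glue uniquely along a covering sieve `S` of `U = p x`.
  The member at `f : V ⟶ U` of a matching family is a map `f^* x ⟶ y` over `f`, i.e. a map from
  `f^* x` to `f^* y` in the fiber over `V`. -/
  existsUnique_hom : ∀ (x y : 𝒴.obj), 𝒴.p.obj y = 𝒴.p.obj x →
    ∀ (S : Sieve (𝒴.p.obj x)), S ∈ J (𝒴.p.obj x) →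
    ∀ (φ : ∀ (z : 𝒴.obj) (a : z ⟶ x), S (𝒴.p.map a) → (z ⟶ y)),
      (∀ (z : 𝒴.obj) (a : z ⟶ x) (h : S (𝒴.p.map a)), 𝒴.p.IsHomLift (𝒴.p.map a) (φ z a h)) →
      (∀ (z w : 𝒴.obj) (b : w ⟶ z) (a : z ⟶ x) (h : S (𝒴.p.map a))
        (h' : S (𝒴.p.map (b ≫ a))), φ w (b ≫ a) h' = b ≫ φ z a h) →
      ∃! ψ : x ⟶ y, 𝒴.p.IsHomLift (𝟙 (𝒴.p.obj x)) ψ ∧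
        ∀ (z : 𝒴.obj) (a : z ⟶ x) (h : S (𝒴.p.map a)), a ≫ ψ = φ z a h
  /-- A descent datum along a sieve `S` of `U` is a functor over `C` from `S`, seen as a full
  subcategory of `C/U`, to `𝒴`. It is effective if it comes from an object over `U`. -/
  effective : ∀ (U : C) (S : Sieve U), S ∈ J U →
    ∀ D : BasedFunctor (BasedCategory.ofFunctor S.arrows.diagram) 𝒴,
      ∃ (x : 𝒴.obj) (c : D.toFunctor ⟶ (Functor.const _).obj x), 𝒴.p.obj x = U ∧
        ∀ f : S.arrows.category, 𝒴.p.IsHomLift f.obj.hom (c.app f)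

/-- The group of automorphisms of `x` in its fiber category, i.e. of those automorphisms that
lie over the identity. -/
abbrev VertAut {C : Type u₁} [Category.{v₁} C] (𝒴 : BasedCategory.{v₂, u₂} C) (x : 𝒴.obj) :
    Subgroup (Aut x) :=
  (𝒴.p.mapAut x).ker

/-- Abelian gerbes over a site. -/
structure IsAbelianGerbe {C : Type u₁} [Category.{v₁} C] (J : GrothendieckTopology C)
    (𝒴 : BasedCategory.{v₂, u₂} C) : Prop extends IsStackInGroupoids J 𝒴 where
  /-- Two objects over `U` have isomorphic pullbacks along the arrows of a cover of `U`. -/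
  locally_isomorphic : ∀ (U : C) (x y : 𝒴.obj), 𝒴.p.obj x = U → 𝒴.p.obj y = U →
    ∃ S ∈ J U, ∀ (V : C) (f : V ⟶ U), S.arrows f →
      ∃ (x' y' : 𝒴.obj) (a : x' ⟶ x) (b : y' ⟶ y) (e : x' ≅ y'),
        𝒴.p.IsHomLift f a ∧ 𝒴.p.IsHomLift f b ∧ 𝒴.p.IsHomLift (𝟙 V) e.hom
  aut_comm : ∀ (x : 𝒴.obj) (a b : VertAut 𝒴 x), a * b = b * a
  locally_nonempty : ∀ U : C, ∃ S ∈ J U, ∀ (V : C) (f : V ⟶ U), S.arrows f →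
    ∃ x : 𝒴.obj, 𝒴.p.obj x = V

set_option linter.checkUnivs false in
/-- A gerbe banded by the abelian sheaf `A`: an abelian gerbe together with an isomorphism
of `A` with its band, i.e. isomorphisms from `A(U)` to the automorphism group of `x` in the fiber
over `U`, for all objects `x` over `U`, which are compatible with all morphisms `ψ : x ⟶ y`.
For `ψ` over an identity this is compatibility with conjugation by `ψ`, and for general `ψ` it
includes compatibility with restriction. -/
structure BandedGerbe {C : Type u₁} [Category.{v₁} C] (J : GrothendieckTopology C)
    (A : Sheaf J AddCommGrpCat.{u}) where
  toBasedCategory : BasedCategory.{v₂, u₂} C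
  isAbelianGerbe : IsAbelianGerbe J toBasedCategory
  band : ∀ x : toBasedCategory.obj,
    Multiplicative (A.obj.obj (op (toBasedCategory.p.obj x))) ≃* VertAut toBasedCategory x
  band_naturality : ∀ (x y : toBasedCategory.obj) (ψ : x ⟶ y)
    (a : A.obj.obj (op (toBasedCategory.p.obj y))),
    (band x (.ofAdd (A.obj.map (toBasedCategory.p.map ψ).op a))).1.hom ≫ ψ =
      ψ ≫ (band y (.ofAdd a)).1.hom

section Glue

variable {C : Type u₁} [Category.{v₁} C] {J : GrothendieckTopology C}

theorem isSheaf_forget_addCommGrpCat (A : Sheaf J AddCommGrpCat.{u}) :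
    Presieve.IsSheaf J (A.obj ⋙ forget AddCommGrpCat.{u}) :=
  Presieve.isSheaf_iso J (Functor.isoWhiskerLeft A.obj AddCommGrpCat.coyonedaObjIsoForget)
    (A.property _)

/-- Sections of a sheaf over `U` are the compatible families indexed by the objects of a gerbe
whose base maps to `U`. -/
theorem IsAbelianGerbe.existsUnique_section {𝒴 : BasedCategory.{v₂, u₂} C}
    (h𝒴 : IsAbelianGerbe J 𝒴) (A : Sheaf J AddCommGrpCat.{u}) {U : C}
    (s : ∀ (x : 𝒴.obj), (𝒴.p.obj x ⟶ U) → A.obj.obj (op (𝒴.p.obj x)))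
    (hs : ∀ (x y : 𝒴.obj) (ψ : y ⟶ x) (f : 𝒴.p.obj x ⟶ U),
      A.obj.map (𝒴.p.map ψ).op (s x f) = s y (𝒴.p.map ψ ≫ f)) :
    ∃! a : A.obj.obj (op U), ∀ (x : 𝒴.obj) (f : 𝒴.p.obj x ⟶ U), A.obj.map f.op a = s x f := by
  have := h𝒴.isFibered
  have hA := isSheaf_forget_addCommGrpCat A
  have mm : ∀ {P Q R : C} (g : P ⟶ Q) (f : Q ⟶ R) (a : A.obj.obj (op R)),
      A.obj.map g.op (A.obj.map f.op a) = A.obj.map (g ≫ f).op a := by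
    intro P Q R g f a; simp
  let σ : ∀ (x : 𝒴.obj) (V : C) (_ : 𝒴.p.obj x = V) (_ : V ⟶ U), A.obj.obj (op V) :=
    fun x V h f => A.obj.map (eqToHom h.symm).op (s x (eqToHom h ≫ f))
  have σ0 : ∀ (x : 𝒴.obj) (f : 𝒴.p.obj x ⟶ U), σ x _ rfl f = s x f := by
    intro x f; simp [σ]
  have σmap : ∀ (x y : 𝒴.obj) (V W : C) (g : W ⟶ V) (ψ : y ⟶ x) (_ : 𝒴.p.IsHomLift g ψ)
      (hx : 𝒴.p.obj x = V) (hy : 𝒴.p.obj y = W) (f : V ⟶ U),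
      A.obj.map g.op (σ x V hx f) = σ y W hy (g ≫ f) := by
    rintro x y V W g ψ ⟨⟩ hx hy f
    simpa [σ] using hs x y ψ f
  have σuniq : ∀ (x y : 𝒴.obj) (V : C) (hx : 𝒴.p.obj x = V) (hy : 𝒴.p.obj y = V) (f : V ⟶ U),
      σ x V hx f = σ y V hy f := by
    intro x y V hx hy f
    obtain ⟨R, hR, H⟩ := h𝒴.locally_isomorphic V x y hx hy
    refine (hA R hR).isSeparatedFor.ext ?_
    intro W g hg
    obtain ⟨x', y', a, b, e, ha, hb, he⟩ := H W g hg
    change A.obj.map g.op _ = A.obj.map g.op _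
    have hx' := IsHomLift.domain_eq 𝒴.p g a
    have hy' := IsHomLift.domain_eq 𝒴.p g b
    rw [σmap x x' V W g a ha hx hx', σmap y y' V W g b hb hy hy']
    have := σmap y' x' W W (𝟙 W) e.hom he hy' hx' (g ≫ f)
    simpa using this.symm
  have pull : ∀ (x : 𝒴.obj) (V W : C) (hx : 𝒴.p.obj x = V) (g : W ⟶ V),
      ∃ (y : 𝒴.obj) (hy : 𝒴.p.obj y = W), ∀ f : V ⟶ U,
        A.obj.map g.op (σ x V hx f) = σ y W hy (g ≫ f) := by
    intro x V W hx g
    obtain ⟨y, ψ, hψ⟩ := IsPreFibered.exists_isCartesian 𝒴.p hx g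
    exact ⟨y, IsHomLift.domain_eq 𝒴.p g ψ, fun f => σmap x y V W g ψ inferInstance hx _ f⟩
  obtain ⟨S, hS, H⟩ := h𝒴.locally_nonempty U
  choose o ho using H
  let t : Presieve.FamilyOfElements (A.obj ⋙ forget AddCommGrpCat.{u}) S.arrows :=
    fun V f hf => σ (o V f hf) V (ho V f hf) f
  have tcomp : t.Compatible := by
    rw [Presieve.compatible_iff_sieveCompatible]
    intro V W f g hf
    obtain ⟨y, hy, H⟩ := pull _ _ _ (ho V f hf) g
    refine Eq.trans ?_ (H f).symm
    exact σuniq _ _ _ _ _ _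
  obtain ⟨a, ha, -⟩ := hA S hS t tcomp
  refine ⟨a, ?_, ?_⟩
  · intro x f
    refine (hA _ (J.pullback_stable f hS)).isSeparatedFor.ext ?_
    intro W g hg
    change A.obj.map g.op _ = A.obj.map g.op _
    rw [mm]
    refine (ha (g ≫ f) hg).trans ?_
    obtain ⟨y, hy, H⟩ := pull x _ _ rfl g
    rw [← σ0, H]
    exact σuniq _ _ _ _ _ _
  · intro b hb
    refine (hA S hS).isSeparatedFor.ext ?_
    intro V f hf
    refine Eq.trans ?_ (ha f hf).symm
    change A.obj.map f.op b = A.obj.map _ (s _ _)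
    rw [← hb, mm]
    simp

end Glue

namespace BandedGerbe

variable {C : Type u₁} [Category.{v₁} C] {J : GrothendieckTopology C}
variable {A A₁ A₂ A₃ : Sheaf J AddCommGrpCat.{u}}

/-- For `x` in the gerbe and `f : p x ⟶ U`, the automorphism of `x` given by `a|_{p x}`, for
`a ∈ A(U)`. -/
def act (𝒴 : BandedGerbe.{u, v₁, u₁, v₂, u₂} J A) (x : 𝒴.toBasedCategory.obj) {U : C}
    (f : 𝒴.toBasedCategory.p.obj x ⟶ U) (a : A.obj.obj (op U)) : x ⟶ x :=
  (𝒴.band x (.ofAdd (A.obj.map f.op a))).1.hom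

/-- A morphism of gerbes is a morphism of categories over `C` (it automatically preserves cartesian
morphisms). A 2-morphism is a base preserving natural transformation, i.e. a morphism in Mathlib's
category of based functors. -/
abbrev Mor (𝒴₁ : BandedGerbe.{u, v₁, u₁, v₂, u₂} J A₁)
    (𝒴₂ : BandedGerbe.{u, v₁, u₁, v₃, u₃} J A₂) :=
  BasedFunctor 𝒴₁.toBasedCategory 𝒴₂.toBasedCategory

section lemmas

variable (𝒴 : BandedGerbe.{u, v₁, u₁, v₂, u₂} J A)

theorem act_isHomLift (x : 𝒴.toBasedCategory.obj) {U : C}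
    (f : 𝒴.toBasedCategory.p.obj x ⟶ U) (a : A.obj.obj (op U)) :
    𝒴.toBasedCategory.p.IsHomLift (𝟙 (𝒴.toBasedCategory.p.obj x)) (𝒴.act x f a) := by
  have h := (𝒴.band x (.ofAdd (A.obj.map f.op a))).2
  have h' : 𝒴.toBasedCategory.p.map (𝒴.act x f a) = 𝟙 _ :=
    congrArg Iso.hom ((MonoidHom.mem_ker (f := 𝒴.toBasedCategory.p.mapAut x)).1 h)
  rw [← h']
  infer_instance

theorem act_naturality {x y : 𝒴.toBasedCategory.obj} (ψ : y ⟶ x) {U : C}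
    (f : 𝒴.toBasedCategory.p.obj x ⟶ U) (a : A.obj.obj (op U)) :
    𝒴.act y (𝒴.toBasedCategory.p.map ψ ≫ f) a ≫ ψ = ψ ≫ 𝒴.act x f a := by
  have := 𝒴.band_naturality y x ψ (A.obj.map f.op a)
  simpa [act] using this

theorem act_map (x : 𝒴.toBasedCategory.obj) {U V : C} (f : 𝒴.toBasedCategory.p.obj x ⟶ U)
    (g : U ⟶ V) (a : A.obj.obj (op V)) :
    𝒴.act x f (A.obj.map g.op a) = 𝒴.act x (f ≫ g) a := by
  simp [act]

theorem act_add (x : 𝒴.toBasedCategory.obj) {U : C} (f : 𝒴.toBasedCategory.p.obj x ⟶ U)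
    (a b : A.obj.obj (op U)) : 𝒴.act x f (a + b) = 𝒴.act x f b ≫ 𝒴.act x f a := by
  simp only [act, map_add, ofAdd_add, map_mul]
  rfl

theorem isIso_of_isHomLift_id {x y : 𝒴.toBasedCategory.obj} {U : C} (φ : x ⟶ y)
    (h : 𝒴.toBasedCategory.p.IsHomLift (𝟙 U) φ) : IsIso φ := by
  have := 𝒴.isAbelianGerbe.isGroupoid_fiber U
  have : IsIso (Functor.Fiber.homMk 𝒴.toBasedCategory.p U φ) := inferInstance
  exact inferInstanceAs
    (IsIso (Functor.Fiber.fiberInclusion.map (Functor.Fiber.homMk 𝒴.toBasedCategory.p U φ)))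

theorem cancel_right {x y z : 𝒴.toBasedCategory.obj} {U : C} (a b : x ⟶ y) (ψ : y ⟶ z)
    (ha : 𝒴.toBasedCategory.p.IsHomLift (𝟙 U) a) (hb : 𝒴.toBasedCategory.p.IsHomLift (𝟙 U) b)
    (h : a ≫ ψ = b ≫ ψ) : a = b := by
  have := 𝒴.isAbelianGerbe.isFibered
  obtain rfl := IsHomLift.codomain_eq 𝒴.toBasedCategory.p (𝟙 U) a
  obtain ⟨c, χ, hχ⟩ := IsPreFibered.exists_isCartesian 𝒴.toBasedCategory.p rfl
    (𝒴.toBasedCategory.p.map ψ)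
  let τ := Functor.IsCartesian.map 𝒴.toBasedCategory.p (𝒴.toBasedCategory.p.map ψ) χ ψ
  have hτ : τ ≫ χ = ψ := Functor.IsCartesian.fac _ _ _ _
  have : IsIso τ := 𝒴.isIso_of_isHomLift_id τ
    (inferInstance : 𝒴.toBasedCategory.p.IsHomLift (𝟙 (𝒴.toBasedCategory.p.obj y)) τ)
  have : a ≫ τ = b ≫ τ := by
    apply Functor.IsCartesian.ext 𝒴.toBasedCategory.p (𝒴.toBasedCategory.p.map ψ) χ
    simpa [hτ] using h
  exact (cancel_mono τ).1 this

theorem existsUnique_band {x : 𝒴.toBasedCategory.obj} (φ : x ⟶ x)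
    (h : 𝒴.toBasedCategory.p.IsHomLift (𝟙 (𝒴.toBasedCategory.p.obj x)) φ) :
    ∃! a : A.obj.obj (op (𝒴.toBasedCategory.p.obj x)), 𝒴.act x (𝟙 _) a = φ := by
  have := 𝒴.isIso_of_isHomLift_id φ h
  let φ' : Aut x := asIso φ
  have hk : φ' ∈ VertAut 𝒴.toBasedCategory x :=
    (MonoidHom.mem_ker (f := 𝒴.toBasedCategory.p.mapAut x)).2
      (Iso.ext (IsHomLift.eq_of_isHomLift _ (𝟙 _) φ).symm)
  refine ⟨((𝒴.band x).symm ⟨φ', hk⟩).toAdd, ?_, ?_⟩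
  · simp [act, φ']
  · intro b hb
    apply Multiplicative.ofAdd.injective
    apply (𝒴.band x).injective
    refine Subtype.ext (Iso.ext ?_)
    have hb' : (𝒴.band x (.ofAdd b)).1.hom = φ := by simpa [act] using hb
    rw [ofAdd_toAdd, MulEquiv.apply_symm_apply]
    exact hb'

theorem act_injective (x : 𝒴.toBasedCategory.obj) {U : C}
    (f : 𝒴.toBasedCategory.p.obj x ⟶ U) (a b : A.obj.obj (op U))
    (h : 𝒴.act x f a = 𝒴.act x f b) : A.obj.map f.op a = A.obj.map f.op b := by
  refine (𝒴.existsUnique_band _ (𝒴.act_isHomLift x f b)).unique ?_ ?_ <;>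
  simp only [act_map, Category.id_comp, h]

end lemmas

/-- A natural family of vertical automorphisms of the objects `K x` with `p x` over `U` is given
by a unique section over `U` of the band. -/
theorem existsUnique_act {𝒴₁ : BandedGerbe.{u, v₁, u₁, v₂, u₂} J A₁}
    {𝒴₂ : BandedGerbe.{u, v₁, u₁, v₃, u₃} J A₂} (K : Mor 𝒴₁ 𝒴₂) {U : C}
    (φ : ∀ x : 𝒴₁.toBasedCategory.obj, (𝒴₁.toBasedCategory.p.obj x ⟶ U) → (K.obj x ⟶ K.obj x))
    (hφ : ∀ x f, 𝒴₂.toBasedCategory.p.IsHomLift (𝟙 (𝒴₁.toBasedCategory.p.obj x)) (φ x f))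
    (nat : ∀ (x y : 𝒴₁.toBasedCategory.obj) (ψ : y ⟶ x) (f : 𝒴₁.toBasedCategory.p.obj x ⟶ U),
      φ y (𝒴₁.toBasedCategory.p.map ψ ≫ f) ≫ K.map ψ = K.map ψ ≫ φ x f) :
    ∃! a : A₂.obj.obj (op U), ∀ x f, 𝒴₂.act (K.obj x) (eqToHom (K.w_obj x) ≫ f) a = φ x f := by
  have key : ∀ x f, ∃! a : A₂.obj.obj (op (𝒴₁.toBasedCategory.p.obj x)),
      𝒴₂.act (K.obj x) (eqToHom (K.w_obj x)) a = φ x f := by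
    intro x f
    have h : 𝒴₂.toBasedCategory.p.IsHomLift (𝟙 (𝒴₂.toBasedCategory.p.obj (K.obj x))) (φ x f) := by
      rw [K.w_obj x]; exact hφ x f
    obtain ⟨a, ha, hu⟩ := 𝒴₂.existsUnique_band _ h
    refine ⟨A₂.obj.map (eqToHom (K.w_obj x).symm).op a, ?_, ?_⟩
    · simp only [act_map, eqToHom_trans, eqToHom_refl, ha]
    · intro b hb
      have := hu (A₂.obj.map (eqToHom (K.w_obj x)).op b) (by simpa only [act_map, Category.id_comp] using hb)
      rw [← this, ← ConcreteCategory.comp_apply, ← Functor.map_comp, ← op_comp]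
      simp
  choose s hs hs' using key
  obtain ⟨a, ha, hu⟩ := 𝒴₁.isAbelianGerbe.existsUnique_section A₂ (U := U) s (by
    intro x y ψ f
    apply hs' y
    have e : 𝒴₂.toBasedCategory.p.map (K.map ψ) ≫ eqToHom (K.w_obj x) =
        eqToHom (K.w_obj y) ≫ 𝒴₁.toBasedCategory.p.map ψ := by
      have := Functor.congr_hom K.w ψ
      simp at this
      simp [this]
    have n := 𝒴₂.act_naturality (K.map ψ) (eqToHom (K.w_obj x)) (s x f)
    rw [act_map, ← e]
    rw [hs x f, ← nat] at n
    refine 𝒴₂.cancel_right _ _ (K.map ψ) (𝒴₂.act_isHomLift _ _ _) ?_ n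
    rw [K.w_obj y]
    exact hφ _ _)
  refine ⟨a, ?_, ?_⟩
  · intro x f
    rw [← hs, ← ha, act_map]
  · intro b hb
    apply hu
    intro x f
    apply hs'
    rw [act_map, hb]

section morphisms

variable {𝒴₁ : BandedGerbe.{u, v₁, u₁, v₂, u₂} J A₁} {𝒴₂ : BandedGerbe.{u, v₁, u₁, v₃, u₃} J A₂}

theorem existsUnique_bandApp (K : Mor 𝒴₁ 𝒴₂) {U : C} (a : A₁.obj.obj (op U)) :
    ∃! b : A₂.obj.obj (op U), ∀ (x : 𝒴₁.toBasedCategory.obj)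
      (f : 𝒴₁.toBasedCategory.p.obj x ⟶ U),
      𝒴₂.act (K.obj x) (eqToHom (K.w_obj x) ≫ f) b = K.map (𝒴₁.act x f a) := by
  refine existsUnique_act K (fun x f => K.map (𝒴₁.act x f a)) ?_ ?_
  · intro x f
    have := 𝒴₁.act_isHomLift x f a
    exact BasedFunctor.preserves_isHomLift K _ _
  · intro x y ψ f
    simp only [← Functor.map_comp, act_naturality]

/-- The homomorphism `A₁ ⟶ A₂` of bands induced by a morphism of gerbes `K`: it sends
`a ∈ A₁(U)` to the unique `b ∈ A₂(U)` such that `K` maps the automorphism of `x` given by `a` to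
the automorphism of `K x` given by `b`, for all `x` whose base maps to `U`. -/
noncomputable def bandMap (K : Mor 𝒴₁ 𝒴₂) : A₁ ⟶ A₂ where
  hom :=
    { app := fun U => AddCommGrpCat.ofHom <| AddMonoidHom.mk'
        (fun a : A₁.obj.obj (op U.unop) => (existsUnique_bandApp K a).choose) (by
          intro a b
          refine (existsUnique_bandApp K (a + b)).unique
            (existsUnique_bandApp K (a + b)).choose_spec.1 ?_
          intro x f
          rw [act_add, act_add, Functor.map_comp,
            (existsUnique_bandApp K a).choose_spec.1, (existsUnique_bandApp K b).choose_spec.1])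
      naturality := by
        intro U V g
        ext a
        refine (existsUnique_bandApp K (A₁.obj.map g a)).unique
            (existsUnique_bandApp K (A₁.obj.map g a)).choose_spec.1 ?_
        intro x f
        have h := (existsUnique_bandApp K a).choose_spec.1 x (f ≫ g.unop)
        have e₁ := 𝒴₁.act_map x f g.unop a
        have e₂ := 𝒴₂.act_map (K.obj x) (eqToHom (K.w_obj x) ≫ f) g.unop
          (existsUnique_bandApp K a).choose
        rw [Category.assoc] at e₂
        exact e₂.trans (h.trans (congrArg K.map e₁.symm)) }

theorem act_bandMap (K : Mor 𝒴₁ 𝒴₂) {U : C} (a : A₁.obj.obj (op U))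
    (x : 𝒴₁.toBasedCategory.obj) (f : 𝒴₁.toBasedCategory.p.obj x ⟶ U) :
    𝒴₂.act (K.obj x) (eqToHom (K.w_obj x) ≫ f) ((bandMap K).hom.app (op U) a) =
      K.map (𝒴₁.act x f a) :=
  (existsUnique_bandApp K a).choose_spec.1 x f

theorem bandMap_app_eq (K : Mor 𝒴₁ 𝒴₂) {U : C} (a : A₁.obj.obj (op U)) (b : A₂.obj.obj (op U))
    (h : ∀ (x : 𝒴₁.toBasedCategory.obj) (f : 𝒴₁.toBasedCategory.p.obj x ⟶ U),
      𝒴₂.act (K.obj x) (eqToHom (K.w_obj x) ≫ f) b = K.map (𝒴₁.act x f a)) :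
    (bandMap K).hom.app (op U) a = b :=
  (existsUnique_bandApp K a).unique (act_bandMap K a) h

/-- A morphism of gerbes `K` is `f`-equivariant if it induces `f` on the bands. -/
def IsEquivariant (K : Mor 𝒴₁ 𝒴₂) (f : A₁ ⟶ A₂) : Prop :=
  bandMap K = f

theorem bandMap_congr {K L : Mor 𝒴₁ 𝒴₂} (s : K ⟶ L) : bandMap K = bandMap L := by
  ext ⟨U⟩ a
  refine bandMap_app_eq K a _ fun x f => ?_
  have := 𝒴₂.isIso_of_isHomLift_id (s.toNatTrans.app x) (s.isHomLift' x)
  rw [← cancel_mono (s.toNatTrans.app x), s.toNatTrans.naturality]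
  have e : eqToHom (K.w_obj x) =
      𝒴₂.toBasedCategory.p.map (s.toNatTrans.app x) ≫ eqToHom (L.w_obj x) := by
    have := s.isHomLift' x
    rw [IsHomLift.fac' 𝒴₂.toBasedCategory.p (𝟙 (𝒴₁.toBasedCategory.p.obj x))
      (s.toNatTrans.app x)]
    simp
  rw [e, Category.assoc, act_naturality, act_bandMap]

theorem bandMap_comp {𝒴₃ : BandedGerbe.{u, v₁, u₁, v₂, u₂} J A₃} (K : Mor 𝒴₁ 𝒴₂)
    (L : Mor 𝒴₂ 𝒴₃) : bandMap (K.comp L) = bandMap K ≫ bandMap L := by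
  ext ⟨U⟩ a
  refine bandMap_app_eq (K.comp L) a _ fun x f => ?_
  have h := act_bandMap L ((bandMap K).hom.app (op U) a) (K.obj x) (eqToHom (K.w_obj x) ≫ f)
  rw [← Category.assoc, eqToHom_trans] at h
  exact h.trans (congrArg L.map (act_bandMap K a x f))

theorem existsUnique_difference {X : C} (hX : IsTerminal X) {K L : Mor 𝒴₁ 𝒴₂} (s t : K ⟶ L) :
    ∃! a : A₂.obj.obj (op X), ∀ x : 𝒴₁.toBasedCategory.obj,
      s.toNatTrans.app x = 𝒴₂.act (K.obj x) (hX.from _) a ≫ t.toNatTrans.app x := by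
  have ht : ∀ x, IsIso (t.toNatTrans.app x) := fun x =>
    𝒴₂.isIso_of_isHomLift_id (t.toNatTrans.app x) (t.isHomLift' x)
  obtain ⟨a, ha, hu⟩ := existsUnique_act (U := X) K
    (fun x _ => s.toNatTrans.app x ≫ inv (t.toNatTrans.app x)) (by
      intro x f
      have := s.isHomLift' x
      have := t.isHomLift' x
      infer_instance) (by
      intro x y ψ f
      have e : inv (t.toNatTrans.app y) ≫ K.map ψ = L.map ψ ≫ inv (t.toNatTrans.app x) := by
        rw [IsIso.inv_comp_eq, ← Category.assoc, IsIso.eq_comp_inv]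
        exact t.toNatTrans.naturality ψ
      rw [Category.assoc, e, ← Category.assoc, ← Category.assoc]
      exact congrArg (· ≫ inv (t.toNatTrans.app x)) (s.toNatTrans.naturality ψ).symm)
  refine ⟨a, fun x => ?_, fun b hb => hu b fun x f => ?_⟩
  · have := ha x (hX.from _)
    rw [hX.hom_ext (hX.from _) (eqToHom (K.w_obj x) ≫ hX.from _), this]
    simp
  · rw [hb x, hX.hom_ext (hX.from _) (eqToHom (K.w_obj x) ≫ f)]
    simp

/-- The difference of two parallel 2-morphisms `s t : K ⟶ L`: the element of `A₂(X)` that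
corresponds to the 2-automorphism `a` of `K` with `t ∘ a = s`, where `X` is the final object. -/
noncomputable def difference {X : C} (hX : IsTerminal X) {K L : Mor 𝒴₁ 𝒴₂} (s t : K ⟶ L) :
    A₂.obj.obj (op X) :=
  (existsUnique_difference hX s t).choose

end morphisms

end BandedGerbe

/-- An action of the group `G` on a banded gerbe. Note that `(F h).comp (F g)` is the composite
`F_g ∘ F_h` and that all 2-morphisms are invertible. -/
structure GerbeAction {C : Type u₁} [Category.{v₁} C] {J : GrothendieckTopology C}
    {A : Sheaf J AddCommGrpCat.{u}} (G : Type u) [Group G]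
    (𝒴 : BandedGerbe.{u, v₁, u₁, v₂, u₂} J A) where
  F : G → BandedGerbe.Mor 𝒴 𝒴
  isEquivariant_one : BandedGerbe.IsEquivariant (F 1) (𝟙 A)
  two_commute : ∀ g h : G, Nonempty (F (g * h) ≅ (F h).comp (F g))

namespace GerbeAction

open BandedGerbe

variable {C : Type u₁} [Category.{v₁} C] {J : GrothendieckTopology C}
  {A : Sheaf J AddCommGrpCat.{u}} {G : Type u} [Group G]
  {𝒴 : BandedGerbe.{u, v₁, u₁, v₂, u₂} J A} (𝒢 : GerbeAction G 𝒴)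

/-- The underlying action of `G` on the sheaf `A`: `g` acts by the map that `F_g` induces on the
band. (Multiplication in `End A` is composition in the usual order, so this is a left action.) -/
noncomputable def underlyingAction : G →* End A where
  toFun g := bandMap (𝒢.F g)
  map_one' := 𝒢.isEquivariant_one
  map_mul' g h := by
    obtain ⟨e⟩ := 𝒢.two_commute g h
    rw [bandMap_congr e.hom, bandMap_comp]
    rfl

/-- The group `A(X)` of global sections with the underlying action of `G`, as a `G`-module. -/
noncomputable def globalSections (X : C) : Rep.{u} (ULift.{u} ℤ) G :=
  Rep.of (X := A.obj.obj (op X))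
    { toFun := fun g =>
        { toFun := fun a => (𝒢.underlyingAction g).hom.app (op X) a
          map_add' := by intros; simp
          map_smul' := by intro r a; simp [ULift.smul_def] }
      map_one' := by ext a; simp
      map_mul' := by intro g h; ext a; simp }

/-- A choice of connecting 2-morphisms `α_{g,h} : F_{gh} ⟶ F_g ∘ F_h`. -/
abbrev Connecting := ∀ g h : G, 𝒢.F (g * h) ⟶ (𝒢.F h).comp (𝒢.F g)

/-- The 3-cochain `κ` with values in `A(X)` of an action with connecting 2-morphisms: the difference
of `(id ⋆ α_{g₂,g₃}) ∘ α_{g₁,g₂g₃}` and `(α_{g₁,g₂} ⋆ id) ∘ α_{g₁g₂,g₃}`, both of which are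
2-morphisms from `F_{g₁g₂g₃}` to `F_{g₁} ∘ F_{g₂} ∘ F_{g₃}`. -/
noncomputable def kappa {X : C} (hX : IsTerminal X) (α : 𝒢.Connecting) :
    (Fin 3 → G) → 𝒢.globalSections X := fun g =>
  difference hX (K := 𝒢.F (g 0 * (g 1 * g 2)))
    (L := ((𝒢.F (g 2)).comp (𝒢.F (g 1))).comp (𝒢.F (g 0)))
    (α (g 0) (g 1 * g 2) ≫ BasedCategory.whiskerRight (α (g 1) (g 2)) (𝒢.F (g 0)))
    (eqToHom (by rw [mul_assoc]) ≫ α (g 0 * g 1) (g 2) ≫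
      BasedCategory.whiskerLeft (𝒢.F (g 2)) (α (g 0) (g 1)))

end GerbeAction

/-! Parallel 2-morphisms `s`, `t` differ by an element of `A(X)`, so they behave like points of an
affine space over `A(X)`. By `difference_trans` these elements add up along paths. Composing with
further 2-morphisms and precomposing with a morphism leaves them unchanged, while postcomposing with
`N` applies `bandMap N` (`difference_whiskerRight`). The last fact is how the underlying action
enters the coboundary formulas.

`kappa` is the difference between the two ways of splitting a triple product. For a fourfold product
there are five bracketings, hence five 2-morphisms to `F₁ ∘ F₂ ∘ F₃ ∘ F₄`, the vertices of Mac
Lane's pentagon. Each edge is a value of `kappa`, one of them acted on by `g 0`. Equating the two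
paths between opposite vertices gives the cocycle identity (`assocDefect_pentagon`).

Two choices `α`, `β` differ by a 2-cochain with values in `A(X)`. Replacing `β` by `α` in both
composites that define `kappa` changes it by the coboundary of that cochain (`assocDefect_sub`), so
the class in `H³` stays the same. -/

namespace inhomogeneousCochains

variable {k G : Type u} [CommRing k] [Group G] (M : Rep.{u} k G)

/-! ### Explicit inhomogeneous differentials in degrees 2 and 3. -/

theorem d_two_apply (f : (Fin 2 → G) → M) (g : Fin 3 → G) :
    d M 2 f g = M.ρ (g 0) (f ![g 1, g 2]) - f ![g 0 * g 1, g 2] + f ![g 0, g 1 * g 2] -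
      f ![g 0, g 1] := by
  have c₀ : Fin.contractNth 0 (· * ·) g = ![g 0 * g 1, g 2] := by
    funext i; fin_cases i <;> rfl
  have c₁ : Fin.contractNth 1 (· * ·) g = ![g 0, g 1 * g 2] := by
    funext i; fin_cases i <;> rfl
  have c₂ : Fin.contractNth 2 (· * ·) g = ![g 0, g 1] := by
    funext i; fin_cases i <;> rfl
  have c₃ : (fun i : Fin 2 => g i.succ) = ![g 1, g 2] := by
    funext i; fin_cases i <;> rfl
  rw [d_hom_apply, Fin.sum_univ_three, c₀, c₁, c₂, c₃]
  simp [pow_succ]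
  abel

theorem d_three_apply (f : (Fin 3 → G) → M) (g : Fin 4 → G) :
    d M 3 f g = M.ρ (g 0) (f ![g 1, g 2, g 3]) - f ![g 0 * g 1, g 2, g 3] +
      f ![g 0, g 1 * g 2, g 3] - f ![g 0, g 1, g 2 * g 3] + f ![g 0, g 1, g 2] := by
  have c₀ : Fin.contractNth 0 (· * ·) g = ![g 0 * g 1, g 2, g 3] := by
    funext i; fin_cases i <;> rfl
  have c₁ : Fin.contractNth 1 (· * ·) g = ![g 0, g 1 * g 2, g 3] := by
    funext i; fin_cases i <;> rfl
  have c₂ : Fin.contractNth 2 (· * ·) g = ![g 0, g 1, g 2 * g 3] := by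
    funext i; fin_cases i <;> rfl
  have c₃ : Fin.contractNth 3 (· * ·) g = ![g 0, g 1, g 2] := by
    funext i; fin_cases i <;> rfl
  have c₄ : (fun i : Fin 3 => g i.succ) = ![g 1, g 2, g 3] := by
    funext i; fin_cases i <;> rfl
  rw [d_hom_apply, Fin.sum_univ_four, c₀, c₁, c₂, c₃, c₄]
  simp [pow_succ]
  abel

end inhomogeneousCochains

/-! ### Calculus of differences of parallel 2-morphisms. -/

namespace BandedGerbe

variable {C : Type u₁} [Category.{v₁} C] {J : GrothendieckTopology C}
  {A : Sheaf J AddCommGrpCat.{u}} {𝒴 : BandedGerbe.{u, v₁, u₁, v₂, u₂} J A}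
  {X : C} (hX : IsTerminal X)

section difference

variable {K L M : Mor 𝒴 𝒴}

theorem difference_spec (s t : K ⟶ L) (x : 𝒴.toBasedCategory.obj) :
    s.toNatTrans.app x =
      𝒴.act (K.obj x) (hX.from _) (difference hX s t) ≫ t.toNatTrans.app x :=
  (existsUnique_difference hX s t).choose_spec.1 x

theorem difference_eq_of_forall (s t : K ⟶ L) (a : A.obj.obj (op X))
    (h : ∀ x : 𝒴.toBasedCategory.obj,
      s.toNatTrans.app x = 𝒴.act (K.obj x) (hX.from _) a ≫ t.toNatTrans.app x) :
    difference hX s t = a :=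
  (existsUnique_difference hX s t).unique (difference_spec hX s t) h

theorem difference_trans (s t r : K ⟶ L) :
    difference hX s r = difference hX s t + difference hX t r := by
  refine difference_eq_of_forall hX _ _ _ fun x => ?_
  -- `act_add` reverses the order of the summands, so they are swapped beforehand.
  rw [add_comm, act_add, Category.assoc, ← difference_spec, ← difference_spec]

theorem difference_self (s : K ⟶ L) : difference hX s s = 0 := by
  simpa using difference_trans hX s s s

theorem difference_symm (s t : K ⟶ L) : difference hX s t = -difference hX t s := by
  rw [eq_neg_iff_add_eq_zero, ← difference_trans, difference_self]

theorem difference_comp_right (s t : K ⟶ L) (r : L ⟶ M) :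
    difference hX (s ≫ r) (t ≫ r) = difference hX s t := by
  refine difference_eq_of_forall hX _ _ _ fun x => ?_
  change s.toNatTrans.app x ≫ r.toNatTrans.app x =
    _ ≫ t.toNatTrans.app x ≫ r.toNatTrans.app x
  rw [← Category.assoc, ← difference_spec]

/-- The automorphisms given by a global section commute with every arrow (`act_naturality`), so they
can be moved past `r`. All maps to the final object agree, so the section is the same on both sides.
-/
theorem difference_comp_left (r : K ⟶ L) (s t : L ⟶ M) :
    difference hX (r ≫ s) (r ≫ t) = difference hX s t := by
  refine difference_eq_of_forall hX _ _ _ fun x => ?_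
  change r.toNatTrans.app x ≫ s.toNatTrans.app x =
    _ ≫ r.toNatTrans.app x ≫ t.toNatTrans.app x
  rw [← Category.assoc, hX.hom_ext (hX.from (𝒴.toBasedCategory.p.obj (K.obj x)))
    (𝒴.toBasedCategory.p.map (r.toNatTrans.app x) ≫ hX.from _), act_naturality, Category.assoc,
    ← difference_spec]

theorem difference_comp (s t : K ⟶ L) (s' t' : L ⟶ M) :
    difference hX (s ≫ s') (t ≫ t') = difference hX s t + difference hX s' t' := by
  rw [difference_trans hX _ (t ≫ s'), difference_comp_right, difference_comp_left]

theorem difference_whiskerLeft (N : Mor 𝒴 𝒴) (s t : K ⟶ L) :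
    difference hX (BasedCategory.whiskerLeft N s) (BasedCategory.whiskerLeft N t) =
      difference hX s t :=
  difference_eq_of_forall hX _ _ _ fun x => difference_spec hX s t (N.obj x)

/-- `N` is applied to the automorphisms that measure the difference, and `bandMap N` records its
effect on them. -/
theorem difference_whiskerRight (s t : K ⟶ L) (N : Mor 𝒴 𝒴) :
    difference hX (BasedCategory.whiskerRight s N) (BasedCategory.whiskerRight t N) =
      (bandMap N).hom.app (op X) (difference hX s t) := by
  refine difference_eq_of_forall hX _ _ _ fun x => ?_
  change N.map (s.toNatTrans.app x) =
    𝒴.act (N.obj (K.obj x)) _ _ ≫ N.map (t.toNatTrans.app x)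
  rw [difference_spec hX s t, Functor.map_comp, ← act_bandMap]
  congr 2
  exact hX.hom_ext _ _

end difference

/-! ### Associativity defects and the pentagon. -/

/-- The associativity defect: for `a : Fp ⟶ Fg ∘ Fhk`, `b : Fhk ⟶ Fh ∘ Fk`,
`c : Fp ⟶ Fgh ∘ Fk` and `d : Fgh ⟶ Fg ∘ Fh`, the difference of the two induced 2-morphisms
`Fp ⟶ Fg ∘ Fh ∘ Fk`. -/
noncomputable def assocDefect {Fg Fh Fk Fgh Fhk Fp : Mor 𝒴 𝒴}
    (a : Fp ⟶ Fhk.comp Fg) (b : Fhk ⟶ Fk.comp Fh) (c : Fp ⟶ Fk.comp Fgh) (d : Fgh ⟶ Fh.comp Fg) :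
    A.obj.obj (op X) :=
  difference hX (K := Fp) (L := (Fk.comp Fh).comp Fg)
    (a ≫ BasedCategory.whiskerRight b Fg) (c ≫ BasedCategory.whiskerLeft Fk d)

/-- The left side sums the edges of the pentagon along three sides and the right side along the
other two. The ten morphisms are arbitrary, so no equalities between products in a group interfere.
-/
theorem assocDefect_pentagon {F₁ F₂ F₃ F₄ F₁₂ F₂₃ F₃₄ F₁₂₃ F₂₃₄ P : Mor 𝒴 𝒴}
    (a₁₂ : F₁₂ ⟶ F₂.comp F₁) (a₂₃ : F₂₃ ⟶ F₃.comp F₂) (a₃₄ : F₃₄ ⟶ F₄.comp F₃)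
    (a₁_₂₃ : F₁₂₃ ⟶ F₂₃.comp F₁) (a₁₂_₃ : F₁₂₃ ⟶ F₃.comp F₁₂)
    (a₂_₃₄ : F₂₃₄ ⟶ F₃₄.comp F₂) (a₂₃_₄ : F₂₃₄ ⟶ F₄.comp F₂₃)
    (b₁ : P ⟶ F₂₃₄.comp F₁) (b₂ : P ⟶ F₃₄.comp F₁₂) (b₃ : P ⟶ F₄.comp F₁₂₃) :
    (bandMap F₁).hom.app (op X) (assocDefect hX a₂_₃₄ a₃₄ a₂₃_₄ a₂₃) +
        assocDefect hX b₁ a₂₃_₄ b₃ a₁_₂₃ + assocDefect hX a₁_₂₃ a₂₃ a₁₂_₃ a₁₂ =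
      assocDefect hX b₁ a₂_₃₄ b₂ a₁₂ + assocDefect hX b₂ a₃₄ b₃ a₁₂_₃ := by
  let L : Mor 𝒴 𝒴 := ((F₄.comp F₃).comp F₂).comp F₁
  -- The vertices `T₁`, ..., `T₅` belong to the bracketings 1(2(34)), 1((23)4), (1(23))4, ((12)3)4
  -- and (12)(34).
  let T₁ : P ⟶ L := b₁ ≫ BasedCategory.whiskerRight
    (a₂_₃₄ ≫ BasedCategory.whiskerRight a₃₄ F₂) F₁
  let T₂ : P ⟶ L := b₁ ≫ BasedCategory.whiskerRight
    (a₂₃_₄ ≫ BasedCategory.whiskerLeft F₄ a₂₃) F₁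
  let T₃ : P ⟶ L := b₃ ≫ BasedCategory.whiskerLeft F₄
    (a₁_₂₃ ≫ BasedCategory.whiskerRight a₂₃ F₁)
  let T₄ : P ⟶ L := b₃ ≫ BasedCategory.whiskerLeft F₄
    (a₁₂_₃ ≫ BasedCategory.whiskerLeft F₃ a₁₂)
  let T₅ : P ⟶ L := (b₂ ≫ BasedCategory.whiskerLeft F₃₄ a₁₂) ≫
    (BasedCategory.whiskerRight (BasedCategory.whiskerRight a₃₄ F₂) F₁ : (F₃₄.comp F₂).comp F₁ ⟶ L)
  have h₁₂ : difference hX T₁ T₂ =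
      (bandMap F₁).hom.app (op X) (assocDefect hX a₂_₃₄ a₃₄ a₂₃_₄ a₂₃) := by
    exact (difference_comp_left hX _ _ _).trans (difference_whiskerRight hX _ _ _)
  have h₃₄ : difference hX T₃ T₄ = assocDefect hX a₁_₂₃ a₂₃ a₁₂_₃ a₁₂ := by
    exact (difference_comp_left hX _ _ _).trans (difference_whiskerLeft hX _ _ _)
  have h₂₃ : difference hX T₂ T₃ = assocDefect hX b₁ a₂₃_₄ b₃ a₁_₂₃ := by
    -- Both `T₂` and `T₃` end by splitting the middle factor with `a₂₃`; this common tail cancels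
    -- from the difference.
    have e₂ : T₂ = (b₁ ≫ BasedCategory.whiskerRight a₂₃_₄ F₁) ≫
        (BasedCategory.whiskerRight (BasedCategory.whiskerLeft F₄ a₂₃) F₁ :
          (F₄.comp F₂₃).comp F₁ ⟶ L) := by
      ext x
      exact (congrArg (b₁.toNatTrans.app x ≫ ·) (F₁.map_comp _ _)).trans (Category.assoc _ _ _).symm
    have e₃ : T₃ = (b₃ ≫ BasedCategory.whiskerLeft F₄ a₁_₂₃ : P ⟶ (F₄.comp F₂₃).comp F₁) ≫
        (BasedCategory.whiskerRight (BasedCategory.whiskerLeft F₄ a₂₃) F₁ :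
          (F₄.comp F₂₃).comp F₁ ⟶ L) := by
      ext x
      exact (Category.assoc _ _ _).symm
    rw [e₂, e₃]
    exact difference_comp_right hX _ _ _
  have h₁₅ : difference hX T₁ T₅ = assocDefect hX b₁ a₂_₃₄ b₂ a₁₂ := by
    have e₁ : T₁ = (b₁ ≫ BasedCategory.whiskerRight a₂_₃₄ F₁) ≫
        (BasedCategory.whiskerRight (BasedCategory.whiskerRight a₃₄ F₂) F₁ :
          (F₃₄.comp F₂).comp F₁ ⟶ L) := by
      ext x
      exact (congrArg (b₁.toNatTrans.app x ≫ ·) (F₁.map_comp _ _)).trans (Category.assoc _ _ _).symm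
    rw [e₁]
    exact difference_comp_right hX _ _ _
  have h₅₄ : difference hX T₅ T₄ = assocDefect hX b₂ a₃₄ b₃ a₁₂_₃ := by
    -- Interchange law: in (12)(34) the two factors may be split in either order, by naturality of
    -- `a₁₂`.
    have e₅ : T₅ = (b₂ ≫ BasedCategory.whiskerRight a₃₄ F₁₂ : P ⟶ (F₄.comp F₃).comp F₁₂) ≫
        (BasedCategory.whiskerLeft (F₄.comp F₃) a₁₂ : (F₄.comp F₃).comp F₁₂ ⟶ L) := by
      ext x
      exact ((Category.assoc _ _ _).trans (congrArg (b₂.toNatTrans.app x ≫ ·)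
        (a₁₂.toNatTrans.naturality (a₃₄.toNatTrans.app x)).symm)).trans (Category.assoc _ _ _).symm
    have e₄ : T₄ = (b₃ ≫ BasedCategory.whiskerLeft F₄ a₁₂_₃ : P ⟶ (F₄.comp F₃).comp F₁₂) ≫
        (BasedCategory.whiskerLeft (F₄.comp F₃) a₁₂ : (F₄.comp F₃).comp F₁₂ ⟶ L) := by
      ext x
      exact (Category.assoc _ _ _).symm
    rw [e₅, e₄]
    exact difference_comp_right hX _ _ _
  rw [← h₁₂, ← h₂₃, ← h₃₄, ← h₁₅, ← h₅₄, ← difference_trans, ← difference_trans,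
    ← difference_trans]

theorem assocDefect_sub {Fg Fh Fk Fgh Fhk Fp : Mor 𝒴 𝒴}
    (a a' : Fp ⟶ Fhk.comp Fg) (b b' : Fhk ⟶ Fk.comp Fh) (c c' : Fp ⟶ Fk.comp Fgh)
    (d d' : Fgh ⟶ Fh.comp Fg) :
    assocDefect hX a b c d - assocDefect hX a' b' c' d' =
      (bandMap Fg).hom.app (op X) (difference hX b b') + difference hX a a' -
        difference hX c c' - difference hX d d' := by
  have h₁ : difference hX (a ≫ BasedCategory.whiskerRight b Fg)
      (a' ≫ BasedCategory.whiskerRight b' Fg) =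
        difference hX a a' + (bandMap Fg).hom.app (op X) (difference hX b b') := by
    rw [difference_comp, difference_whiskerRight]
  have h₂ : difference hX (c ≫ BasedCategory.whiskerLeft Fk d)
      (c' ≫ BasedCategory.whiskerLeft Fk d') = difference hX c c' + difference hX d d' := by
    rw [difference_comp, difference_whiskerLeft]
  let s : Fp ⟶ (Fk.comp Fh).comp Fg := a ≫ BasedCategory.whiskerRight b Fg
  let s' : Fp ⟶ (Fk.comp Fh).comp Fg := a' ≫ BasedCategory.whiskerRight b' Fg
  let t : Fp ⟶ (Fk.comp Fh).comp Fg := c ≫ BasedCategory.whiskerLeft Fk d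
  let t' : Fp ⟶ (Fk.comp Fh).comp Fg := c' ≫ BasedCategory.whiskerLeft Fk d'
  have h₁' : difference hX s s' = _ := h₁
  have h₂' : difference hX t t' = _ := h₂
  -- The difference of `s` and `t'` is computed through `t` and through `s'`.
  have h := (difference_trans hX s t t').symm.trans (difference_trans hX s s' t')
  change difference hX s t - difference hX s' t' = _
  rw [h₁', h₂'] at h
  rw [eq_sub_of_add_eq h]
  abel

end BandedGerbe

/-! ### The cocycle identity and the change of connecting 2-morphisms. -/

namespace GerbeAction

open BandedGerbe

variable {C : Type u₁} [Category.{v₁} C] {J : GrothendieckTopology C}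
  {A : Sheaf J AddCommGrpCat.{u}} {G : Type u} [Group G]
  {𝒴 : BandedGerbe.{u, v₁, u₁, v₂, u₂} J A} (𝒢 : GerbeAction G 𝒴)
  {X : C} (hX : IsTerminal X)

/-- The connecting 2-morphism `F_p ⟶ F_g ∘ F_h` for an element `p` equal to `g * h`. -/
def Connecting.cast {𝒢 : GerbeAction G 𝒴} (α : 𝒢.Connecting) {g h p : G} (e : p = g * h) :
    𝒢.F p ⟶ (𝒢.F h).comp (𝒢.F g) :=
  eqToHom (by rw [e]) ≫ α g h

theorem Connecting.difference_cast {𝒢 : GerbeAction G 𝒴} (α β : 𝒢.Connecting) {g h p : G}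
    (e : p = g * h) :
    difference hX (cast α e) (cast β e) = difference hX (α g h) (β g h) :=
  difference_comp_left hX _ _ _

open Connecting

/-- The partial products are free variables with equations, so that defects whose products are
bracketed differently can share the same morphisms, as the pentagon requires. -/
theorem kappa_eq_assocDefect (α : 𝒢.Connecting) {f : Fin 3 → G} {g h k gh hk p : G}
    (hf : f = ![g, h, k]) (h₁ : p = g * hk) (h₂ : hk = h * k) (h₃ : p = gh * k) (h₄ : gh = g * h) :
    𝒢.kappa hX α f = assocDefect hX (cast α h₁) (cast α h₂) (cast α h₃) (cast α h₄) := by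
  subst hf h₂ h₄ h₁
  refine Eq.trans ?_ (congrArg (difference hX _) (Category.assoc _ _ _).symm)
  simp only [Connecting.cast, eqToHom_refl, Category.id_comp]
  rfl

theorem d_kappa (α : 𝒢.Connecting) :
    inhomogeneousCochains.d (𝒢.globalSections X) 3 (𝒢.kappa hX α) = 0 := by
  funext g
  have key := assocDefect_pentagon hX
    (cast α (p := g 0 * g 1) rfl) (cast α (p := g 1 * g 2) rfl) (cast α (p := g 2 * g 3) rfl)
    (cast α (p := g 0 * g 1 * g 2) (mul_assoc _ _ _)) (cast α rfl)
    (cast α (p := g 1 * g 2 * g 3) (mul_assoc _ _ _)) (cast α rfl)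
    (cast α (p := g 0 * g 1 * g 2 * g 3) (by simp only [mul_assoc]))
    (cast α (mul_assoc _ _ _)) (cast α rfl)
  rw [← 𝒢.kappa_eq_assocDefect hX α rfl, ← 𝒢.kappa_eq_assocDefect hX α rfl,
    ← 𝒢.kappa_eq_assocDefect hX α rfl, ← 𝒢.kappa_eq_assocDefect hX α rfl,
    ← 𝒢.kappa_eq_assocDefect hX α rfl] at key
  refine (inhomogeneousCochains.d_three_apply _ _ _).trans ?_
  refine Eq.trans ?_ (sub_eq_zero.2 key)
  -- The rearrangement takes place in `A(X)`, with which the module `globalSections` agrees by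
  -- definition.
  have e (a b c d e : A.obj.obj (op X)) : a - b + c - d + e = a + c + e - (d + b) := by abel
  exact e _ _ _ _ _

/-- The 2-cochain of differences of two choices of connecting 2-morphisms. -/
noncomputable def differenceCochain (α β : 𝒢.Connecting) : (Fin 2 → G) → 𝒢.globalSections X :=
  fun g => difference hX (α (g 0) (g 1)) (β (g 0) (g 1))

theorem d_differenceCochain (α β : 𝒢.Connecting) :
    inhomogeneousCochains.d (𝒢.globalSections X) 2 (𝒢.differenceCochain hX α β) =
      𝒢.kappa hX α - 𝒢.kappa hX β := by
  funext g
  have hg : g = ![g 0, g 1, g 2] := by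
    funext i; fin_cases i <;> rfl
  have m := (mul_assoc (g 0) (g 1) (g 2)).symm
  have key := assocDefect_sub hX (cast α rfl) (cast β rfl)
    (cast α rfl) (cast β rfl) (cast α m) (cast β m) (cast α rfl) (cast β rfl)
  rw [← 𝒢.kappa_eq_assocDefect hX α hg, ← 𝒢.kappa_eq_assocDefect hX β hg] at key
  simp only [difference_cast] at key
  refine (inhomogeneousCochains.d_two_apply _ _ _).trans (Eq.trans ?_ key.symm)
  have e (a b c d : A.obj.obj (op X)) : a - b + c - d = a + c - b - d := by abel
  exact e _ _ _ _

end GerbeAction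

/-! ### From cohomologous cochains to equal classes. -/

namespace groupCohomology

theorem π_cocyclesMk_eq_of_d_eq_sub {k G : Type u} [CommRing k] [Group G] {M : Rep.{u} k G} {n : ℕ}
    {f f' : (Fin (n + 1) → G) → M} (hf : inhomogeneousCochains.d M (n + 1) f = 0)
    (hf' : inhomogeneousCochains.d M (n + 1) f' = 0) (c : (Fin n → G) → M)
    (hc : inhomogeneousCochains.d M n c = f - f') :
    π M (n + 1) (cocyclesMk f hf) = π M (n + 1) (cocyclesMk f' hf') := by
  have e : cocyclesMk f hf - cocyclesMk f' hf' = toCocycles M n (n + 1) c := by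
    -- Cocycles embed into cochains, so the equation may be checked there, where it is `hc`.
    apply (ModuleCat.mono_iff_injective (iCocycles M (n + 1))).1 inferInstance
    have h := ConcreteCategory.congr_hom
      ((inhomogeneousCochains M).toCycles_i n (n + 1)) c
    rw [inhomogeneousCochains.d_def] at h
    rw [map_sub, iCocycles_mk, iCocycles_mk]
    exact (h.trans hc).symm
  rw [← sub_eq_zero, ← map_sub, e]
  exact ConcreteCategory.congr_hom
    ((inhomogeneousCochains M).toCycles_comp_homologyπ n (n + 1)) c

end groupCohomology

theorem proposition4p23 {C : Type u₁} [Category.{v₁} C] {J : GrothendieckTopology C}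
    {X : C} (hX : IsTerminal X) {A : Sheaf J AddCommGrpCat.{u}}
    (𝒴 : BandedGerbe.{u, v₁, u₁, v₂, u₂} J A)
    {G : Type u} [Group G] [Finite G] (𝒢 : GerbeAction G 𝒴) :
    ∃ isCocycle : ∀ α : 𝒢.Connecting,
        inhomogeneousCochains.d (𝒢.globalSections X) 3 (𝒢.kappa hX α) = 0,
      ∀ α β : 𝒢.Connecting,
        groupCohomology.π (𝒢.globalSections X) 3
            (groupCohomology.cocyclesMk (𝒢.kappa hX α) (isCocycle α)) =
          groupCohomology.π (𝒢.globalSections X) 3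
            (groupCohomology.cocyclesMk (𝒢.kappa hX β) (isCocycle β)) :=
  ⟨𝒢.d_kappa hX, fun α β =>
    groupCohomology.π_cocyclesMk_eq_of_d_eq_sub _ _ _ (𝒢.d_differenceCochain hX α β)⟩
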